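/- Let $n\ge 1$ and let $k_1\le k_2\le\dots\le k_n$ be integers. A Gelfand--Tsetlin pattern with bottom row $(k_1,\dots,k_n)$ is an array of integers $(a_{i,j})_{1\le i\le j\le n}$ with $a_{1,j}=k_j$ for $1\le j\le n$, $a_{i,j}\le a_{i+1,j+1}$ for $1\le i\le j<n$, and $a_{i,j}\le a_{i-1,j}$ for $1<i\le j\le n$. It is called a weak monotone triangle if moreover $a_{i,j-1}<a_{i-1,j}$ whenever $1<i<j\le n$. The $P$-weight of a weak monotone triangle is $$\prod_{\substack{1<i\le j\le n\\ a_{i,j}<a_{i-1,j}}}\bigl(P^{a_{i,j}}-[a_{i,j}=a_{i,j-1}]\bigr),$$ where $[\cdot]$ is $1$ if the statement in brackets is true and $0$ otherwise, and $[a_{i,j}=a_{i,j-1}]$ is read as $0$ for $j=i$ (no left neighbour). Here $P$ is an indeterminate or, more generally, a nonzero element of a field with $P^m\ne 1$ for $1\le m<n$. For a function $f$ of the integer variables $k_1,\dots,k_n$ let $E_{k_x}$ be the shift operator that replaces $k_x$ by $k_x+1$, and set ${}_P\Delta_{k_x}=P^{-k_x}(E_{k_x}-\operatorname{id})$ and ${}_PE_{k_x}={}_P\Delta_{k_x}+\operatorname{id}$;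 these operators commute with each other. Then there are only finitely many weak monotone triangles with bottom row $(k_1,\dots,k_n)$, and the sum of their $P$-weights is $$P^{\binom{n+1}{3}}\;\prod_{1\le s<t\le n}\bigl({}_PE_{k_t}+{}_P\Delta_{k_s}\,{}_P\Delta_{k_t}\bigr)\;\prod_{1\le i<j\le n}\frac{P^{k_j}-P^{k_i}}{P^j-P^i},$$ where the product of operators is their composition, applied to the last product as a function of $(k_1,\dots,k_n)\in\mathbb Z^n$ and then evaluated at the given $(k_1,\dots,k_n)$. -/

import Mathlib

/-- A Gelfand–Tsetlin pattern `(a i j)`, `1 ≤ i ≤ j ≤ n`, of integers. Row `i = 1` is the bottom row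
and has `n` entries, row `i = n` is the top row and has one entry. The array is extended by `0`
outside of the index range, so that distinct functions are distinct patterns. -/
structure IsGelfandTsetlin (n : ℕ) (a : ℕ → ℕ → ℤ) : Prop where
  le_northeast : ∀ i j, 1 ≤ i → i ≤ j → j < n → a i j ≤ a (i + 1) (j + 1)
  le_southeast : ∀ i j, 1 < i → i ≤ j → j ≤ n → a i j ≤ a (i - 1) j
  zero_outside : ∀ i j, ¬ (1 ≤ i ∧ i ≤ j ∧ j ≤ n) → a i j = 0

/-- A weak monotone triangle with `n` rows. -/
structure IsWeakMonotoneTriangle (n : ℕ) (a : ℕ → ℕ → ℤ) : Prop extends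
    IsGelfandTsetlin n a where
  lt_of_ne_bottom : ∀ i j, 1 < i → i < j → j ≤ n → a i (j - 1) < a (i - 1) j

/-- The weak monotone triangles with bottom row `k`; `k j` is the entry in position `j + 1`. -/
def weakMonotoneTriangles {n : ℕ} (k : Fin n → ℤ) : Set (ℕ → ℕ → ℤ) :=
  {a | IsWeakMonotoneTriangle n a ∧ ∀ j : Fin n, a 1 ((j : ℕ) + 1) = k j}

/-- The index pairs of the entries `a i j` that have a southeast neighbour `a (i - 1) j` (that is,
`i ≠ 1`) and are strictly smaller than it. -/
def strictIndices (n : ℕ) (a : ℕ → ℕ → ℤ) : Finset (ℕ × ℕ) :=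
  (Finset.Icc 1 n ×ˢ Finset.Icc 1 n).filter
    fun p => 1 < p.1 ∧ p.1 ≤ p.2 ∧ a p.1 p.2 < a (p.1 - 1) p.2

/-- The `P`-weight of a triangle. The Iverson bracket is `0` for the leftmost entry `i = j` of a row,
which has no left neighbour. -/
def pWeight {K : Type*} [Field K] (P : K) (n : ℕ) (a : ℕ → ℕ → ℤ) : K :=
  ∏ p ∈ strictIndices n a,
    (P ^ a p.1 p.2 - if p.1 < p.2 ∧ a p.1 p.2 = a p.1 (p.2 - 1) then 1 else 0)

/-- The shift operator `E_{k_x}` on functions of `(k_1, …, k_n) ∈ ℤⁿ`. -/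
def shiftOp (K : Type*) [Field K] {n : ℕ} (x : Fin n) : Module.End K ((Fin n → ℤ) → K) where
  toFun f := fun k => f (Function.update k x (k x + 1))
  map_add' _ _ := rfl
  map_smul' _ _ := rfl

/-- Multiplication by the function `P ^ (-k_x)`. -/
def powNegOp {K : Type*} [Field K] (P : K) {n : ℕ} (x : Fin n) :
    Module.End K ((Fin n → ℤ) → K) where
  toFun f := fun k => P ^ (-k x) * f k
  map_add' _ _ := by ext; simp [mul_add]
  map_smul' _ _ := by ext; simp [mul_left_comm]

/-- The `P`-difference operator `P ^ (-k_x) (E_{k_x} - id)`. -/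
def pDelta {K : Type*} [Field K] (P : K) {n : ℕ} (x : Fin n) : Module.End K ((Fin n → ℤ) → K) :=
  powNegOp P x * (shiftOp K x - 1)

/-- The `P`-shift operator. -/
def pShift {K : Type*} [Field K] (P : K) {n : ℕ} (x : Fin n) : Module.End K ((Fin n → ℤ) → K) :=
  pDelta P x + 1

/-- The factor belonging to the pair `(s, t)`. -/
def pairOp {K : Type*} [Field K] (P : K) {n : ℕ} (p : Fin n × Fin n) :
    Module.End K ((Fin n → ℤ) → K) :=
  pShift P p.2 + pDelta P p.1 * pDelta P p.2

theorem pDelta_commute {K : Type*} [Field K] (P : K) {n : ℕ} (x y : Fin n) :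
    Commute (pDelta P x) (pDelta P y) := by
  rcases eq_or_ne x y with rfl | h
  · exact Commute.refl _
  · refine LinearMap.ext fun f => funext fun k => ?_
    simp only [pDelta, powNegOp, shiftOp, Module.End.mul_apply, LinearMap.sub_apply,
      Module.End.one_apply, LinearMap.coe_mk, AddHom.coe_mk, Pi.sub_apply,
      Function.update_of_ne h, Function.update_of_ne h.symm, Function.update_comm h]
    ring

theorem pairOp_commute {K : Type*} [Field K] (P : K) {n : ℕ} (p q : Fin n × Fin n) :
    Commute (pairOp P p) (pairOp P q) := by
  have h := pDelta_commute P (n := n)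
  have hl : ∀ x, Commute (pDelta P x) (pairOp P q) := fun x =>
    (((h x _).add_right (Commute.one_right _))).add_right ((h x _).mul_right (h x _))
  exact (((hl _).add_left (Commute.one_left _))).add_left ((hl _).mul_left (hl _))

/-- The composition of the factors over all pairs `s < t`; the factors commute. -/
def pairOpProd {K : Type*} [Field K] (P : K) (n : ℕ) : Module.End K ((Fin n → ℤ) → K) :=
  (Finset.univ.filter fun p : Fin n × Fin n => p.1 < p.2).noncommProd (pairOp P)
    fun p _ q _ _ => pairOp_commute P p q

/-- The product of `(P ^ k_j - P ^ k_i) / (P ^ j - P ^ i)` over `1 ≤ i < j ≤ n`, as a function of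
`k`. An element `i` of `Fin n` stands for the index `i + 1`. -/
def pVandermonde {K : Type*} [Field K] (P : K) (n : ℕ) : (Fin n → ℤ) → K := fun k =>
  ∏ p ∈ Finset.univ.filter (fun p : Fin n × Fin n => p.1 < p.2),
    (P ^ k p.2 - P ^ k p.1) / (P ^ ((p.2 : ℕ) + 1) - P ^ ((p.1 : ℕ) + 1))

/-!
The operators `pDelta P x` commute, so polynomials in `n` variables act on functions on `ℤⁿ`, and
the formula becomes `F n = q n (det (φ_j (k_i)))` for a polynomial `q n` and functions `φ_j` whose
`P`-differences are `φ_{j-1}`. Deleting the bottom row `k` of a triangle, it suffices that the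
weighted sum of `F n` over the rows interlacing `k` is `F (n + 1)`.

Put `G n = q n (det (φ_{j+1} (k_i)))`, so that `F n` is the `P`-difference of `G n` in all
variables. The row weights `P ^ y` turn `P`-differences into ordinary ones, so the sum telescopes to
an alternating sum of values of `G n`, except for corrections where neighbouring entries agree.
These cancel: the product of `q n` and the pair polynomial of `(j, j - 1)` is invariant under
exchanging the variables `j - 1` and `j`, so applied to a determinant it gives a function that
vanishes on `k_{j-1} = k_j`. The alternating sum is the Laplace expansion of the determinant in
`F (n + 1)` along the constant column `φ_0`.
-/

open MvPolynomial

section CommutingFamily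

variable {R ι κ : Type*} [CommRing R]

/-- Evaluation of polynomials at a family of pairwise commuting elements of an algebra which need
not be commutative itself. -/
noncomputable def aevalOfCommute {A : Type*} [Ring A] [Algebra R A] (D : ι → A)
    (hD : ∀ i j, Commute (D i) (D j)) : MvPolynomial ι R →ₐ[R] A :=
  letI : CommRing (Algebra.adjoin R (Set.range D)) :=
    { (Algebra.adjoin R (Set.range D)).toRing with
      mul_comm := (Algebra.isMulCommutative_adjoin R (by
        rintro _ ⟨i, rfl⟩ _ ⟨j, rfl⟩
        exact hD i j)).is_comm.comm }
  (Algebra.adjoin R (Set.range D)).val.comp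
    (aeval fun i => ⟨D i, Algebra.subset_adjoin ⟨i, rfl⟩⟩)

@[simp]
theorem aevalOfCommute_X {A : Type*} [Ring A] [Algebra R A] (D : ι → A)
    (hD : ∀ i j, Commute (D i) (D j)) (i : ι) : aevalOfCommute (R := R) D hD (X i) = D i := by
  simp [aevalOfCommute]

variable {M N : Type*} [AddCommGroup M] [Module R M] [AddCommGroup N] [Module R N]

theorem aevalOfCommute_intertwine {D : ι → Module.End R M} {hD : ∀ i j, Commute (D i) (D j)}
    {D' : κ → Module.End R N} {hD' : ∀ i j, Commute (D' i) (D' j)} (T : M →ₗ[R] N)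
    (θ : κ → MvPolynomial ι R) (hT : ∀ x m, D' x (T m) = T (aevalOfCommute D hD (θ x) m))
    (q : MvPolynomial κ R) (m : M) :
    aevalOfCommute D' hD' q (T m) = T (aevalOfCommute D hD (aeval θ q) m) := by
  induction q using MvPolynomial.induction_on generalizing m with
  | C a =>
    simp only [← algebraMap_eq, AlgHom.commutes, Module.algebraMap_end_apply, map_smul]
  | add p q hp hq => simp only [map_add, LinearMap.add_apply, hp, hq]
  | mul_X p x hp =>
    simp only [map_mul, Module.End.mul_apply, aevalOfCommute_X, aeval_X, hT, hp]

end CommutingFamily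

section DeltaAction

variable {K : Type*} [Field K] (P : K) {m n : ℕ}

theorem pDelta_apply (x : Fin n) (f : (Fin n → ℤ) → K) (k : Fin n → ℤ) :
    pDelta P x f k = P ^ (-k x) * (f (Function.update k x (k x + 1)) - f k) := rfl

/-- The action of polynomials on functions of `n` integer variables in which `X x` acts as the
`P`-difference operator in the variable `x`. -/
noncomputable def deltaAct : MvPolynomial (Fin n) K →ₐ[K] Module.End K ((Fin n → ℤ) → K) :=
  aevalOfCommute (pDelta P) (pDelta_commute P)

@[simp]
theorem deltaAct_X (x : Fin n) : deltaAct P (X x) = pDelta P x :=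
  aevalOfCommute_X _ _ _

theorem deltaAct_mul_apply (p q : MvPolynomial (Fin n) K) (f : (Fin n → ℤ) → K) :
    deltaAct P (p * q) f = deltaAct P p (deltaAct P q f) := by
  rw [map_mul, Module.End.mul_apply]

variable (K) in
/-- The function `l ↦ f (l ∘ e)`, that is, `f` with its variables renamed along `e`. -/
def reindex (e : Fin m → Fin n) : ((Fin m → ℤ) → K) →ₗ[K] ((Fin n → ℤ) → K) :=
  LinearMap.funLeft K K fun l => l ∘ e

theorem reindex_apply (e : Fin m → Fin n) (f : (Fin m → ℤ) → K) (l : Fin n → ℤ) :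
    reindex K e f l = f (l ∘ e) := rfl

theorem pDelta_reindex {e : Fin m → Fin n} (he : Function.Injective e) (y : Fin m)
    (f : (Fin m → ℤ) → K) : pDelta P (e y) (reindex K e f) = reindex K e (pDelta P y f) := by
  ext l
  simp only [pDelta_apply, reindex_apply, Function.update_comp_eq_of_injective _ he,
    Function.comp_apply]

theorem pDelta_reindex_of_notMem_range {e : Fin m → Fin n} {x : Fin n} (hx : x ∉ Set.range e)
    (f : (Fin m → ℤ) → K) : pDelta P x (reindex K e f) = 0 := by
  ext l
  simp only [pDelta_apply, reindex_apply, Function.update_comp_eq_of_notMem_range _ _ hx,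
    sub_self, mul_zero, Pi.zero_apply]

theorem deltaAct_reindex {e : Fin m → Fin n} (he : Function.Injective e)
    (q : MvPolynomial (Fin n) K) (f : (Fin m → ℤ) → K) :
    deltaAct P q (reindex K e f) = reindex K e (deltaAct P (killCompl he q) f) := by
  classical
  refine aevalOfCommute_intertwine (reindex K e) _ (fun x f => ?_) q f
  change _ = reindex K e (deltaAct P _ f)
  split_ifs with hx
  · obtain ⟨y, rfl⟩ := hx
    rw [Equiv.ofInjective_symm_apply, deltaAct_X, pDelta_reindex P he]
  · rw [pDelta_reindex_of_notMem_range P hx, map_zero, LinearMap.zero_apply, map_zero]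

theorem deltaAct_reindex_perm (σ : Equiv.Perm (Fin n)) {q : MvPolynomial (Fin n) K}
    (hq : rename σ q = q) (f : (Fin n → ℤ) → K) :
    deltaAct P q (reindex K σ f) = reindex K σ (deltaAct P q f) := by
  have hkill : killCompl σ.injective q = q := by
    conv_lhs => rw [← hq, killCompl_rename_app]
  rw [deltaAct_reindex P σ.injective, hkill]

variable (K) in
/-- The function of the remaining variables obtained by giving the first variable the value `y`. -/
def fixFirst (y : ℤ) : ((Fin (n + 1) → ℤ) → K) →ₗ[K] ((Fin n → ℤ) → K) :=
  LinearMap.funLeft K K fun l => (Fin.cons y l : Fin (n + 1) → ℤ)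

theorem fixFirst_apply (y : ℤ) (f : (Fin (n + 1) → ℤ) → K) (l : Fin n → ℤ) :
    fixFirst K y f l = f (Fin.cons y l) := rfl

theorem fixFirst_tail (f : (Fin (n + 1) → ℤ) → K) (l : Fin (n + 1) → ℤ) :
    fixFirst K (l 0) f (Fin.tail l) = f l := by
  rw [fixFirst_apply, Fin.cons_self_tail]

theorem pDelta_fixFirst (y : ℤ) (x : Fin n) (f : (Fin (n + 1) → ℤ) → K) :
    pDelta P x (fixFirst K y f) = fixFirst K y (pDelta P x.succ f) := by
  ext l
  simp only [pDelta_apply, fixFirst_apply, Fin.cons_succ, Fin.cons_update]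

theorem deltaAct_fixFirst (y : ℤ) (q : MvPolynomial (Fin n) K) (f : (Fin (n + 1) → ℤ) → K) :
    deltaAct P q (fixFirst K y f) = fixFirst K y (deltaAct P (rename Fin.succ q) f) := by
  rw [rename_eq_aeval]
  refine aevalOfCommute_intertwine (fixFirst K y) _ (fun x f => ?_) q f
  rw [Function.comp_apply, aevalOfCommute_X, pDelta_fixFirst]

theorem fixFirst_pDelta_zero (y : ℤ) (f : (Fin (n + 1) → ℤ) → K) :
    fixFirst K y (pDelta P 0 f) = P ^ (-y) • (fixFirst K (y + 1) f - fixFirst K y f) := by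
  ext l
  simp [pDelta_apply, fixFirst_apply]

theorem fixFirst_deltaAct_prod_X (y : ℤ) (f : (Fin (n + 1) → ℤ) → K) :
    fixFirst K y (deltaAct P (∏ t, X t) f) =
      deltaAct P (∏ t, X t) (fixFirst K y (pDelta P 0 f)) := by
  rw [deltaAct_fixFirst, ← deltaAct_X, ← deltaAct_mul_apply, Fin.prod_univ_succ, mul_comm]
  simp only [map_prod, rename_X]

end DeltaAction

section PairPolynomial

variable {K : Type*} [Field K] {n : ℕ}

variable (K) in
/-- The polynomial acting as the operator `pairOp P p` of the pair `p`. -/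
noncomputable def pairPoly (p : Fin n × Fin n) : MvPolynomial (Fin n) K :=
  X p.2 + 1 + X p.1 * X p.2

variable (K n) in
/-- The polynomial acting as the operator product `pairOpProd P n`. -/
noncomputable def pairPolyProd : MvPolynomial (Fin n) K :=
  ∏ p : Fin n × Fin n with p.1 < p.2, pairPoly K p

theorem deltaAct_pairPolyProd (P : K) : deltaAct P (pairPolyProd K n) = pairOpProd P n := by
  rw [pairPolyProd, ← Finset.noncommProd_eq_prod]
  refine (Finset.map_noncommProd _ _ _ _).trans (Finset.noncommProd_congr rfl (fun p _ => ?_) _)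
  simp only [pairPoly, map_add, map_mul, map_one, deltaAct_X, pairOp, pShift]

theorem rename_pairPoly {m : ℕ} (e : Fin m → Fin n) (p : Fin m × Fin m) :
    rename e (pairPoly K p) = pairPoly K (e p.1, e p.2) := by
  simp only [pairPoly, map_add, map_mul, map_one, rename_X]

theorem val_add_one_eq_of_covBy {i j : Fin n} (hij : i ⋖ j) : (i : ℕ) + 1 = j :=
  Order.covBy_iff_add_one_eq.mp (Fin.covBy_iff.mp hij)

theorem swap_prod_swap_mem_insert {i j : Fin n} (hij : i ⋖ j) {p : Fin n × Fin n}
    (hp : p ∈ insert (j, i) ({p | p.1 < p.2} : Finset (Fin n × Fin n))) :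
    (Equiv.swap i j p.1, Equiv.swap i j p.2) ∈
      insert (j, i) ({p | p.1 < p.2} : Finset (Fin n × Fin n)) := by
  obtain ⟨s, t⟩ := p
  have hval := val_add_one_eq_of_covBy hij
  simp only [Finset.mem_insert, Prod.mk.injEq, Finset.mem_filter_univ, Equiv.swap_apply_def] at hp ⊢
  split_ifs <;> grind

theorem rename_swap_pairPolyProd {i j : Fin n} (hij : i ⋖ j) :
    rename (Equiv.swap i j) (pairPoly K (j, i) * pairPolyProd K n) =
      pairPoly K (j, i) * pairPolyProd K n := by
  have hmem : (j, i) ∉ ({p | p.1 < p.2} : Finset (Fin n × Fin n)) := by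
    simpa using hij.lt.le
  rw [pairPolyProd, ← Finset.prod_insert hmem, map_prod]
  refine Finset.prod_equiv ((Equiv.swap i j).prodCongr (Equiv.swap i j)) (fun p => ?_)
    fun p _ => rename_pairPoly _ p
  refine ⟨swap_prod_swap_mem_insert hij, fun hp => ?_⟩
  simpa using swap_prod_swap_mem_insert hij hp

theorem killCompl_succAbove_X_self (i : Fin (n + 1)) :
    killCompl (R := K) (Fin.succAbove_right_injective (p := i)) (X i) = 0 := by
  rw [killCompl, aeval_X, dif_neg (by simp)]

theorem killCompl_succAbove_X (i : Fin (n + 1)) (t : Fin n) :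
    killCompl (R := K) (Fin.succAbove_right_injective (p := i)) (X (i.succAbove t)) = X t := by
  rw [← rename_X, killCompl_rename_app]

theorem killCompl_succAbove_pairPolyProd (i : Fin (n + 1)) :
    killCompl (Fin.succAbove_right_injective (p := i)) (pairPolyProd K (n + 1)) =
      (∏ t : Fin n with i ≤ t.castSucc, (X t + 1)) * pairPolyProd K n := by
  simp only [pairPolyProd, Finset.prod_filter, Fintype.prod_prod_type, map_prod]
  rw [Fin.prod_univ_succAbove _ i]
  simp only [Fin.prod_univ_succAbove _ i, lt_self_iff_false, ↓reduceIte, map_one, one_mul,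
    apply_ite, Fin.succAbove_lt_succAbove_iff, pairPoly, map_add, map_mul, killCompl_succAbove_X,
    killCompl_succAbove_X_self, Fin.lt_succAbove_iff_le_castSucc]
  simp

end PairPolynomial

section FunDet

variable {K : Type*} [Field K] {n : ℕ}

/-- The determinant of the matrix with entries `φ j (l m)`, as a function of `l`. -/
def funDet (φ : Fin n → ℤ → K) (l : Fin n → ℤ) : K :=
  (Matrix.of fun m j => φ j (l m)).det

theorem funDet_eq_sum_reindex (φ : Fin n → ℤ → K) :
    funDet φ = ∑ σ : Equiv.Perm (Fin n),
      Equiv.Perm.sign σ • reindex K σ fun l => ∏ j, φ j (l j) := by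
  ext l
  simp only [funDet, Matrix.det_apply, Matrix.of_apply, Finset.sum_apply, Pi.smul_apply,
    reindex_apply, Function.comp_apply]

theorem deltaAct_funDet (P : K) (q : MvPolynomial (Fin n) K) (φ : Fin n → ℤ → K)
    (l : Fin n → ℤ) :
    deltaAct P q (funDet φ) l = ∑ σ : Equiv.Perm (Fin n),
      Equiv.Perm.sign σ • deltaAct P q (reindex K σ fun l => ∏ j, φ j (l j)) l := by
  rw [funDet_eq_sum_reindex, map_sum, Finset.sum_apply]
  refine Finset.sum_congr rfl fun σ _ => ?_
  rw [map_zsmul_unit, Pi.smul_apply]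

theorem reindex_swap_mul (i j : Fin n) (σ : Equiv.Perm (Fin n)) (f : (Fin n → ℤ) → K) :
    reindex K (Equiv.swap i j * σ) f = reindex K (Equiv.swap i j) (reindex K σ f) := rfl

theorem comp_swap_eq_self {i j : Fin n} {l : Fin n → ℤ} (hl : l i = l j) :
    l ∘ Equiv.swap i j = l := by
  rw [Equiv.comp_swap_eq_update, hl, Function.update_eq_self, ← hl, Function.update_eq_self]

/-- The terms of `σ` and `swap i j * σ` in the expansion of the determinant cancel. -/
theorem deltaAct_funDet_eq_zero (P : K) {q : MvPolynomial (Fin n) K} {i j : Fin n} (hij : i ≠ j)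
    (hq : rename (Equiv.swap i j) q = q) (φ : Fin n → ℤ → K) {l : Fin n → ℤ} (hl : l i = l j) :
    deltaAct P q (funDet φ) l = 0 := by
  rw [deltaAct_funDet]
  refine Finset.sum_involution (fun σ _ => Equiv.swap i j * σ) (fun σ _ => ?_)
    (fun σ _ _ h => ?_) (fun _ _ => Finset.mem_univ _) (fun σ _ => Equiv.swap_mul_self_mul i j σ)
  · rw [reindex_swap_mul, deltaAct_reindex_perm P _ hq, reindex_apply, comp_swap_eq_self hl,
      Equiv.Perm.sign_mul, Equiv.Perm.sign_swap hij, neg_one_mul, Units.neg_smul, add_neg_cancel]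
  · exact hij (Equiv.swap_eq_one_iff.mp (mul_eq_right.mp h))

theorem deltaAct_prod_X_prod (P : K) : ∀ {n : ℕ} (φ : Fin n → ℤ → K) (l : Fin n → ℤ),
    deltaAct P (∏ t, X t) (fun l => ∏ j, φ j (l j)) l =
      ∏ j, P ^ (-l j) * (φ j (l j + 1) - φ j (l j))
  | 0, φ, l => by simp
  | n + 1, φ, l => by
    have hfix : fixFirst K (l 0) (pDelta P 0 fun l => ∏ j, φ j (l j)) =
        (P ^ (-l 0) * (φ 0 (l 0 + 1) - φ 0 (l 0))) • fun l => ∏ j : Fin n, φ j.succ (l j) := by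
      ext l'
      simp only [fixFirst_pDelta_zero, Pi.smul_apply, Pi.sub_apply, smul_eq_mul]
      simp only [fixFirst_apply, Fin.prod_univ_succ, Fin.cons_zero, Fin.cons_succ]
      ring
    rw [← fixFirst_tail (deltaAct P _ _) l, fixFirst_deltaAct_prod_X, hfix, map_smul, Pi.smul_apply,
      deltaAct_prod_X_prod, Fin.prod_univ_succ, smul_eq_mul]
    simp only [Fin.tail]

theorem rename_prod_X {R σ : Type*} [CommSemiring R] [Fintype σ] (e : Equiv.Perm σ) :
    rename e (∏ t, X t : MvPolynomial σ R) = ∏ t, X t := by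
  simp only [map_prod, rename_X, Equiv.prod_comp e fun t => (X t : MvPolynomial σ R)]

theorem deltaAct_prod_X_funDet (P : K) (φ : Fin n → ℤ → K) :
    deltaAct P (∏ t, X t) (funDet φ) =
      funDet fun j y => P ^ (-y) * (φ j (y + 1) - φ j y) := by
  ext l
  rw [deltaAct_funDet, funDet_eq_sum_reindex, Finset.sum_apply]
  refine Finset.sum_congr rfl fun σ _ => ?_
  rw [deltaAct_reindex_perm P σ (rename_prod_X σ), Pi.smul_apply, reindex_apply, reindex_apply,
    deltaAct_prod_X_prod]

end FunDet

section OperatorFormula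

variable {K : Type*} [Field K] (P : K) {n : ℕ}

/-- The divided powers of the `P`-difference calculus in one variable, normalized so that the
`P`-difference operator sends `divPow P (m + 1)` to `divPow P m`. -/
def divPow (m : ℕ) (y : ℤ) : K :=
  (P ^ y) ^ m / ∏ r ∈ Finset.range m, (P ^ (r + 1) - 1)

theorem divPow_zero (y : ℤ) : divPow P 0 y = 1 := by
  simp [divPow]

variable {P} in
theorem diff_divPow_succ (hP0 : P ≠ 0) {m : ℕ} (hm : P ^ (m + 1) ≠ 1) (y : ℤ) :
    P ^ (-y) * (divPow P (m + 1) (y + 1) - divPow P (m + 1) y) = divPow P m y := by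
  have hcancel : (P ^ (m + 1) - 1) / (P ^ (m + 1) - 1) = 1 := div_self (sub_ne_zero.mpr hm)
  calc P ^ (-y) * (divPow P (m + 1) (y + 1) - divPow P (m + 1) y)
      = P ^ (-y) * P ^ y * divPow P m y * ((P ^ (m + 1) - 1) / (P ^ (m + 1) - 1)) := by
        rw [divPow, divPow, divPow, Finset.prod_range_succ, zpow_add_one₀ hP0, ← div_div,
          ← div_div]
        ring
    _ = divPow P m y := by
        rw [hcancel, ← zpow_add₀ hP0, neg_add_cancel, zpow_zero, one_mul, mul_one]

variable (n) in
/-- The sum of the weights of the weak monotone triangles, up to the normalization of the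
Vandermonde product. -/
noncomputable def operatorFormula : (Fin n → ℤ) → K :=
  deltaAct P (pairPolyProd K n) (funDet fun j => divPow P j)

variable (n) in
/-- The function whose `P`-difference in all variables is `operatorFormula P n`. -/
noncomputable def operatorPrimitive : (Fin n → ℤ) → K :=
  deltaAct P (pairPolyProd K n) (funDet fun j => divPow P (j + 1))

variable {P} in
theorem deltaAct_prod_X_operatorPrimitive (hP0 : P ≠ 0)
    (hP : ∀ m : ℕ, 0 < m → m < n + 1 → P ^ m ≠ 1) :
    deltaAct P (∏ t, X t) (operatorPrimitive P n) = operatorFormula P n := by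
  rw [operatorPrimitive, ← deltaAct_mul_apply, mul_comm, deltaAct_mul_apply,
    deltaAct_prod_X_funDet, operatorFormula]
  simp only [diff_divPow_succ hP0 (hP _ (Nat.succ_pos _) (Nat.succ_lt_succ (Fin.is_lt _)))]

/-- The condition on a function that makes the boundary terms of the row summation cancel. -/
def DiagonalVanishing (g : (Fin n → ℤ) → K) : Prop :=
  ∀ ⦃i j : Fin n⦄, i ⋖ j → ∀ ⦃l : Fin n → ℤ⦄, l i = l j → deltaAct P (pairPoly K (j, i)) g l = 0

theorem diagonalVanishing_deltaAct_pairPolyProd (φ : Fin n → ℤ → K) :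
    DiagonalVanishing P (deltaAct P (pairPolyProd K n) (funDet φ)) := by
  intro i j hij l hl
  rw [← deltaAct_mul_apply]
  exact deltaAct_funDet_eq_zero P hij.ne (rename_swap_pairPolyProd hij) φ hl

/-- The alternating sum over the entries of `k` that arises when a function is summed over all rows
that interlace `k`; the entries to the right of the omitted one are shifted. -/
noncomputable def altSum (k : Fin (n + 1) → ℤ) : ((Fin n → ℤ) → K) →ₗ[K] K :=
  ∑ i : Fin (n + 1), (-1 : K) ^ (i : ℕ) • LinearMap.proj (i.removeNth k) ∘ₗ
    deltaAct P (∏ t : Fin n with i ≤ t.castSucc, (X t + 1))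

theorem altSum_apply (k : Fin (n + 1) → ℤ) (g : (Fin n → ℤ) → K) :
    altSum P k g = ∑ i : Fin (n + 1), (-1) ^ (i : ℕ) *
      deltaAct P (∏ t : Fin n with i ≤ t.castSucc, (X t + 1)) g (i.removeNth k) := by
  simp only [altSum, LinearMap.sum_apply, LinearMap.smul_apply, LinearMap.comp_apply,
    LinearMap.proj_apply, smul_eq_mul]

/-- Laplace expansion along a constant column. -/
theorem funDet_divPow_succ :
    (funDet fun j : Fin (n + 1) => divPow P j) = ∑ i : Fin (n + 1),
      (-1 : K) ^ (i : ℕ) • reindex K i.succAbove (funDet fun j : Fin n => divPow P (j + 1)) := by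
  ext k
  rw [funDet, Matrix.det_succ_column_zero, Finset.sum_apply]
  refine Finset.sum_congr rfl fun i _ => ?_
  simp [divPow_zero, funDet, reindex_apply, Matrix.submatrix]

theorem operatorFormula_succ (k : Fin (n + 1) → ℤ) :
    operatorFormula P (n + 1) k = altSum P k (operatorPrimitive P n) := by
  rw [operatorFormula, funDet_divPow_succ, map_sum, Finset.sum_apply, altSum_apply]
  refine Finset.sum_congr rfl fun i _ => ?_
  rw [operatorPrimitive, ← deltaAct_mul_apply, ← killCompl_succAbove_pairPolyProd, map_smul,
    deltaAct_reindex P Fin.succAbove_right_injective]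
  rfl

theorem altSum_zero (k : Fin 1 → ℤ) (g : (Fin 0 → ℤ) → K) : altSum P k g = g 0 := by
  simp [altSum_apply, Subsingleton.elim (Fin.removeNth 0 k) 0]

theorem altSum_succ (k : Fin (n + 2) → ℤ) (g : (Fin (n + 1) → ℤ) → K) :
    altSum P k g = deltaAct P (∏ t, (X t + 1)) g (Fin.tail k) -
      altSum P (Fin.tail k) (fixFirst K (k 0) g) := by
  rw [altSum_apply, Fin.sum_univ_succ, altSum_apply, sub_eq_add_neg, ← Finset.sum_neg_distrib]
  congr 1
  · simp
  · refine Finset.sum_congr rfl fun i _ => ?_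
    have hprod : (∏ t : Fin (n + 1) with i.succ ≤ t.castSucc, (X t + 1) :
        MvPolynomial (Fin (n + 1)) K) =
          rename Fin.succ (∏ t : Fin n with i ≤ t.castSucc, (X t + 1)) := by
      simp [Finset.prod_filter, Fin.prod_univ_succ, apply_ite, Fin.le_castSucc_iff]
    have hremove : Fin.cons (k 0) (i.removeNth (Fin.tail k)) = i.succ.removeNth k := by
      rw [← Fin.cons_comp_succ_succAbove, Fin.cons_self_tail]
      rfl
    rw [deltaAct_fixFirst, fixFirst_apply, hprod, hremove, Fin.val_succ, pow_succ]
    ring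

end OperatorFormula

section RowSum

variable {K : Type*} [Field K] (P : K) {n : ℕ}

/-- The rows that interlace the row `k` below them. -/
noncomputable def rowsAbove (k : Fin (n + 1) → ℤ) : Finset (Fin n → ℤ) :=
  Finset.Icc (Fin.init k) (Fin.tail k)

theorem mem_rowsAbove {k : Fin (n + 1) → ℤ} {l : Fin n → ℤ} :
    l ∈ rowsAbove k ↔ ∀ j, k j.castSucc ≤ l j ∧ l j ≤ k j.succ := by
  simp only [rowsAbove, Finset.mem_Icc, Pi.le_def, Fin.init, Fin.tail, forall_and]

theorem cons_mem_rowsAbove {k : Fin (n + 2) → ℤ} {y : ℤ} {l : Fin n → ℤ} :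
    (Fin.cons y l : Fin (n + 1) → ℤ) ∈ rowsAbove k ↔
      y ∈ Finset.Icc (k 0) (k 1) ∧ l ∈ rowsAbove (Fin.tail k) := by
  simp [mem_rowsAbove, Fin.forall_fin_succ (n := n), Fin.tail]

/-- The factor of the weight contributed by an entry `y` with left neighbour `x` and southeast
neighbour `c`. It vanishes for `x = y = c`, so that rows which are excluded from a weak monotone
triangle get weight zero. -/
def entryWeight (x c y : ℤ) : K :=
  (if y < c then P ^ y else 1) - if y = x then 1 else 0

/-- The weight of the row `l` above the row `k`. The first entry of `l`, which has no left
neighbour, is given the left neighbour `x`. -/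
def rowWeight (x : ℤ) (k : Fin (n + 1) → ℤ) (l : Fin n → ℤ) : K :=
  ∏ j : Fin n, entryWeight P ((Fin.cons x l : Fin (n + 1) → ℤ) j.castSucc) (k j.succ) (l j)

theorem rowWeight_cons (x y : ℤ) (k : Fin (n + 2) → ℤ) (l : Fin n → ℤ) :
    rowWeight P x k (Fin.cons y l : Fin (n + 1) → ℤ) =
      entryWeight P x (k 1) y * rowWeight P y (Fin.tail k) l := by
  simp [rowWeight, Fin.prod_univ_succ (n := n), Fin.tail]

/-- The weighted sum of `f` over all rows above `k`. -/
noncomputable def rowSum (x : ℤ) (k : Fin (n + 1) → ℤ) (f : (Fin n → ℤ) → K) : K :=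
  ∑ l ∈ rowsAbove k, rowWeight P x k l * f l

theorem rowSum_zero (x : ℤ) (k : Fin 1 → ℤ) (f : (Fin 0 → ℤ) → K) : rowSum P x k f = f 0 := by
  have hrows : rowsAbove k = {0} := by
    ext l
    simp [mem_rowsAbove, Subsingleton.elim l 0]
  simp [rowSum, rowWeight, hrows]

theorem rowSum_succ (x : ℤ) (k : Fin (n + 2) → ℤ) (f : (Fin (n + 1) → ℤ) → K) :
    rowSum P x k f = ∑ y ∈ Finset.Icc (k 0) (k 1),
      entryWeight P x (k 1) y * rowSum P y (Fin.tail k) (fixFirst K y f) := by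
  simp only [rowSum, Finset.mul_sum]
  rw [← Finset.sum_product']
  symm
  refine Finset.sum_equiv (Fin.consEquiv fun _ => ℤ) (fun p => ?_) fun p _ => ?_
  · rw [Finset.mem_product, ← cons_mem_rowsAbove]
    rfl
  · rw [fixFirst_apply, ← mul_assoc, ← rowWeight_cons]
    rfl

variable {P} in
theorem entryWeight_of_ne {x y : ℤ} (h : y ≠ x) (c : ℤ) :
    entryWeight P x c y = if y < c then P ^ y else 1 := by
  rw [entryWeight, if_neg h, sub_zero]

variable {P} in
theorem entryWeight_self_of_ne {x c : ℤ} (h : c ≠ x) : entryWeight P x c c = 1 := by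
  rw [entryWeight_of_ne h, if_neg (lt_irrefl c)]

theorem rowSum_eq_of_lt {x x' : ℤ} {k : Fin (n + 1) → ℤ} (hx : x < k 0) (hx' : x' < k 0)
    (f : (Fin n → ℤ) → K) : rowSum P x k f = rowSum P x' k f := by
  cases n with
  | zero => rw [rowSum_zero, rowSum_zero]
  | succ n =>
    rw [rowSum_succ, rowSum_succ]
    refine Finset.sum_congr rfl fun y hy => ?_
    have hy0 := (Finset.mem_Icc.mp hy).1
    rw [entryWeight_of_ne (hx.trans_le hy0).ne', entryWeight_of_ne (hx'.trans_le hy0).ne']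

theorem rowSum_head_eq_sub {x : ℤ} {k : Fin (n + 2) → ℤ} (hk : k 0 ≤ k 1) (hx : x < k 0)
    (f : (Fin (n + 1) → ℤ) → K) :
    rowSum P (k 0) k f =
      rowSum P x k f - rowSum P (k 0) (Fin.tail k) (fixFirst K (k 0) f) := by
  have hweight : ∀ y ∈ Finset.Icc (k 0) (k 1),
      entryWeight P (k 0) (k 1) y * rowSum P y (Fin.tail k) (fixFirst K y f) =
        entryWeight P x (k 1) y * rowSum P y (Fin.tail k) (fixFirst K y f) -
          if y = k 0 then rowSum P y (Fin.tail k) (fixFirst K y f) else 0 := fun y hy => by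
    rw [entryWeight_of_ne (hx.trans_le (Finset.mem_Icc.mp hy).1).ne', entryWeight, sub_mul,
      boole_mul]
  rw [rowSum_succ, rowSum_succ, Finset.sum_congr rfl hweight, Finset.sum_sub_distrib,
    Finset.sum_ite_eq', if_pos (Finset.left_mem_Icc.mpr hk)]

/-- Three consecutive entries of `l` are equal, so that `l` is not the bottom row of a weak monotone
triangle. -/
def HasTriple (l : Fin n → ℤ) : Prop :=
  ∃ a i b : Fin n, a ⋖ i ∧ i ⋖ b ∧ l a = l i ∧ l i = l b

theorem HasTriple.cons {l : Fin n → ℤ} (h : HasTriple l) (y : ℤ) :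
    HasTriple (Fin.cons y l : Fin (n + 1) → ℤ) := by
  obtain ⟨a, i, b, hai, hib, hl⟩ := h
  exact ⟨a.succ, i.succ, b.succ, by simpa using hai, by simpa using hib, by simpa using hl⟩

theorem hasTriple_cons_cons_cons (y : ℤ) (l : Fin n → ℤ) :
    HasTriple (Fin.cons y (Fin.cons y (Fin.cons y l : Fin (n + 1) → ℤ) : Fin (n + 2) → ℤ) :
      Fin (n + 3) → ℤ) :=
  ⟨0, 1, 2, Fin.covBy_iff.mpr (Order.covBy_iff_add_one_eq.mpr rfl),
    Fin.covBy_iff.mpr (Order.covBy_iff_add_one_eq.mpr rfl), rfl, rfl⟩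

theorem rowSum_eq_of_hasTriple {x x' : ℤ} {k : Fin (n + 1) → ℤ} (hk : Monotone k) (hx : x ≤ k 0)
    (hx' : x' < k 0) {f : (Fin n → ℤ) → K}
    (hf : ∀ l ∈ rowsAbove k,
      HasTriple (Fin.cons x (Fin.cons x l : Fin (n + 1) → ℤ) : Fin (n + 2) → ℤ) → f l = 0) :
    rowSum P x k f = rowSum P x' k f := by
  obtain hlt | rfl := hx.lt_or_eq
  · exact rowSum_eq_of_lt P hlt hx' f
  cases n with
  | zero => rw [rowSum_zero, rowSum_zero]
  | succ n =>
    have hk01 : k 0 ≤ k 1 := hk (Fin.zero_le 1)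
    have hzero : rowSum P (k 0) (Fin.tail k) (fixFirst K (k 0) f) = 0 :=
      Finset.sum_eq_zero fun l hl => by
        rw [fixFirst_apply, hf _ (cons_mem_rowsAbove.mpr ⟨by simp [hk01], hl⟩)
          (hasTriple_cons_cons_cons _ l), mul_zero]
    rw [rowSum_head_eq_sub P hk01 hx', hzero, sub_zero]

end RowSum

section RowSummation

variable {K : Type*} [Field K] {P : K} {n : ℕ}

theorem sum_Ico_add_one_sub {a c : ℤ} (hac : a ≤ c) (h : ℤ → K) :
    ∑ y ∈ Finset.Ico a c, (h (y + 1) - h y) = h c - h a := by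
  induction c, hac using Int.leInduction with
  | base => simp
  | succ c hac ih =>
    rw [← Finset.insert_Ico_right_eq_Ico_add_one hac, Finset.sum_insert Finset.right_notMem_Ico, ih,
      sub_add_sub_cancel]

theorem sum_entryWeight_mul_diff (hP0 : P ≠ 0) {x a c : ℤ} (hx : x < a) (hac : a ≤ c) (h : ℤ → K) :
    ∑ y ∈ Finset.Icc a c, entryWeight P x c y * (P ^ (-y) * (h (y + 1) - h y)) =
      h c + P ^ (-c) * (h (c + 1) - h c) - h a := by
  have hstrict : ∀ y ∈ Finset.Ico a c,
      entryWeight P x c y * (P ^ (-y) * (h (y + 1) - h y)) = h (y + 1) - h y := fun y hy => by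
    obtain ⟨hay, hyc⟩ := Finset.mem_Ico.mp hy
    rw [entryWeight_of_ne (hx.trans_le hay).ne', if_pos hyc, zpow_neg,
      mul_inv_cancel_left₀ (zpow_ne_zero y hP0)]
  rw [← Finset.Ico_insert_right hac, Finset.sum_insert Finset.right_notMem_Ico,
    Finset.sum_congr rfl hstrict, sum_Ico_add_one_sub hac,
    entryWeight_self_of_ne (hx.trans_le hac).ne']
  ring

theorem map_fixFirst_pDelta_zero (L : ((Fin n → ℤ) → K) →ₗ[K] K) (y : ℤ)
    (g : (Fin (n + 1) → ℤ) → K) :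
    L (fixFirst K y (pDelta P 0 g)) =
      P ^ (-y) * (L (fixFirst K (y + 1) g) - L (fixFirst K y g)) := by
  rw [fixFirst_pDelta_zero, map_smul, map_sub, smul_eq_mul]

theorem sum_entryWeight_mul_map (hP0 : P ≠ 0) {x a c : ℤ} (hx : x < a) (hac : a ≤ c)
    (L : ((Fin n → ℤ) → K) →ₗ[K] K) (g : (Fin (n + 1) → ℤ) → K) :
    ∑ y ∈ Finset.Icc a c, entryWeight P x c y * L (fixFirst K y (pDelta P 0 g)) =
      L (fixFirst K c (deltaAct P (X 0 + 1) g)) - L (fixFirst K a g) := by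
  simp only [map_fixFirst_pDelta_zero]
  rw [sum_entryWeight_mul_diff hP0 hx hac fun y => L (fixFirst K y g),
    ← map_fixFirst_pDelta_zero, ← map_add, ← map_add, map_add (deltaAct P), deltaAct_X, map_one,
    add_comm g]
  rfl

theorem DiagonalVanishing.fixFirst_pDelta {g : (Fin (n + 1) → ℤ) → K} (hg : DiagonalVanishing P g)
    (y : ℤ) : DiagonalVanishing P (fixFirst K y (pDelta P 0 g)) := by
  intro i j hij l hl
  have hzero : ∀ z, fixFirst K z (deltaAct P (pairPoly K (j.succ, i.succ)) g) l = 0 := fun z =>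
    hg (by simpa using hij) (by simpa using hl)
  rw [deltaAct_fixFirst, rename_pairPoly, ← deltaAct_X, ← deltaAct_mul_apply, mul_comm,
    deltaAct_mul_apply, deltaAct_X, fixFirst_pDelta_zero, Pi.smul_apply, Pi.sub_apply, hzero, hzero,
    sub_zero, smul_zero]

theorem fixFirst_deltaAct_prod_X_add_one (y : ℤ) (g : (Fin (n + 1) → ℤ) → K) :
    fixFirst K y (deltaAct P (∏ t, (X t + 1)) g) =
      deltaAct P (∏ t, (X t + 1)) (fixFirst K y (deltaAct P (X 0 + 1) g)) := by
  rw [deltaAct_fixFirst, ← deltaAct_mul_apply, Fin.prod_univ_succ, mul_comm]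
  simp only [map_prod, map_add, map_one, rename_X]

theorem altSum_tail_fixFirst (k : Fin (n + 3) → ℤ) {g : (Fin (n + 2) → ℤ) → K}
    (hg : DiagonalVanishing P g) :
    altSum P (Fin.tail k) (fixFirst K (k 1) (deltaAct P (X 0 + 1) g)) =
      deltaAct P (∏ t, (X t + 1)) g (Fin.tail k) +
        altSum P (Fin.tail (Fin.tail k))
          (fixFirst K (k 1) (pDelta P 0 (fixFirst K (k 1) (pDelta P 0 g)))) := by
  have hcancel : fixFirst K (k 1) (fixFirst K (k 1) (deltaAct P (X 0 + 1) g)) +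
      fixFirst K (k 1) (pDelta P 0 (fixFirst K (k 1) (pDelta P 0 g))) = 0 := by
    rw [pDelta_fixFirst, ← map_add, ← map_add, ← deltaAct_X, ← deltaAct_X, ← deltaAct_mul_apply,
      ← LinearMap.add_apply, ← map_add]
    ext l
    exact hg (i := 0) (j := Fin.succ 0) (by simp [Fin.covBy_iff])
      (l := Fin.cons (k 1) (Fin.cons (k 1) l : Fin (n + 1) → ℤ)) rfl
  have hhead : Fin.tail k 0 = k 1 := rfl
  rw [altSum_succ, hhead, ← fixFirst_deltaAct_prod_X_add_one, ← hhead, fixFirst_tail,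
    sub_eq_add_neg, hhead, ← map_neg, neg_eq_of_add_eq_zero_right hcancel]

/-- The conditions on a row `k` and a function `g` under which the `P`-difference of `g` in all
variables can be summed in closed form over the rows above `k`. -/
structure IsRowSummable (P : K) (k : Fin (n + 1) → ℤ) (g : (Fin n → ℤ) → K) : Prop where
  monotone : Monotone k
  diagonalVanishing : DiagonalVanishing P g
  apply_eq_zero : ∀ l ∈ rowsAbove k, HasTriple l → deltaAct P (∏ t, X t) g l = 0

theorem IsRowSummable.head_le {k : Fin (n + 2) → ℤ} {g : (Fin (n + 1) → ℤ) → K}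
    (h : IsRowSummable P k g) : k 0 ≤ k 1 :=
  h.monotone (Fin.zero_le 1)

theorem IsRowSummable.tail {k : Fin (n + 2) → ℤ} {g : (Fin (n + 1) → ℤ) → K}
    (h : IsRowSummable P k g) {y : ℤ} (hy : y ∈ Finset.Icc (k 0) (k 1)) :
    IsRowSummable P (Fin.tail k) (fixFirst K y (pDelta P 0 g)) where
  monotone := h.monotone.comp Fin.strictMono_succ.monotone
  diagonalVanishing := h.diagonalVanishing.fixFirst_pDelta y
  apply_eq_zero l hl hl3 := by
    rw [← fixFirst_deltaAct_prod_X, fixFirst_apply]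
    exact h.apply_eq_zero _ (cons_mem_rowsAbove.mpr ⟨hy, hl⟩) (hl3.cons y)

theorem IsRowSummable.rowSum_corner_eq {k : Fin (n + 3) → ℤ} {g : (Fin (n + 2) → ℤ) → K}
    (h : IsRowSummable P k g) {x : ℤ} (hx : x < k 1) :
    rowSum P (k 1) (Fin.tail (Fin.tail k))
        (fixFirst K (k 1) (fixFirst K (k 1) (deltaAct P (∏ t, X t) g))) =
      rowSum P x (Fin.tail (Fin.tail k))
        (fixFirst K (k 1) (fixFirst K (k 1) (deltaAct P (∏ t, X t) g))) := by
  have hmem := Finset.right_mem_Icc.mpr h.head_le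
  have hle : Fin.tail k 0 ≤ Fin.tail k 1 := (h.tail hmem).head_le
  refine rowSum_eq_of_hasTriple P
    (h.monotone.comp (Fin.strictMono_succ.comp Fin.strictMono_succ).monotone)
    hle (hx.trans_le hle) fun l hl hl3 => ?_
  exact h.apply_eq_zero _
    (cons_mem_rowsAbove.mpr ⟨hmem, cons_mem_rowsAbove.mpr ⟨Finset.left_mem_Icc.mpr hle, hl⟩⟩) hl3

theorem rowSum_pair_eq_altSum (hP0 : P ≠ 0) {x : ℤ} {k : Fin 2 → ℤ} (g : (Fin 1 → ℤ) → K)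
    (hk : k 0 ≤ k 1) (hx : x < k 0) :
    rowSum P x k (deltaAct P (∏ t, X t) g) = altSum P k g := by
  have hrow : ∀ y, rowSum P y (Fin.tail k) (fixFirst K y (deltaAct P (∏ t, X t) g)) =
      altSum P (Fin.tail k) (fixFirst K y (pDelta P 0 g)) := fun y => by
    rw [rowSum_zero, altSum_zero, fixFirst_deltaAct_prod_X, Fin.prod_univ_zero, map_one,
      Module.End.one_apply]
  have hlast : altSum P (Fin.tail k) (fixFirst K (k 1) (deltaAct P (X 0 + 1) g)) =
      deltaAct P (∏ t, (X t + 1)) g (Fin.tail k) := by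
    rw [altSum_zero, Fin.prod_univ_one, ← fixFirst_tail (deltaAct P _ g) (Fin.tail k),
      Subsingleton.elim (Fin.tail (Fin.tail k)) 0]
    rfl
  rw [rowSum_succ, Finset.sum_congr rfl fun y _ => by rw [hrow],
    sum_entryWeight_mul_map hP0 hx hk, hlast, altSum_succ]

/-- With `c = k 1`, only the entry `y = c` needs a correction, because then the rest of the row
starts at its own left neighbour; the correction cancels by `altSum_tail_fixFirst`. -/
theorem IsRowSummable.rowSum_eq_altSum (hP0 : P ≠ 0) :
    ∀ {n : ℕ} {x : ℤ} {k : Fin (n + 1) → ℤ} {g : (Fin n → ℤ) → K}, IsRowSummable P k g → x < k 0 →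
      rowSum P x k (deltaAct P (∏ t, X t) g) = altSum P k g
  | 0, x, k, g, _, _ => by
    rw [rowSum_zero, altSum_zero, Fin.prod_univ_zero, map_one, Module.End.one_apply]
  | 1, x, k, g, h, hx => rowSum_pair_eq_altSum hP0 g h.head_le hx
  | n + 2, x, k, g, h, hx => by
    set f := deltaAct P (∏ t, X t) g with hf
    set r := altSum P (Fin.tail (Fin.tail k))
      (fixFirst K (k 1) (pDelta P 0 (fixFirst K (k 1) (pDelta P 0 g)))) with hr
    have hmem : k 1 ∈ Finset.Icc (k 0) (k 1) := Finset.right_mem_Icc.mpr h.head_le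
    have hle : Fin.tail k 0 ≤ Fin.tail k 1 := (h.tail hmem).head_le
    have hrow : ∀ y ∈ Finset.Icc (k 0) (k 1), ∀ x' < k 1,
        rowSum P x' (Fin.tail k) (fixFirst K y f) =
          altSum P (Fin.tail k) (fixFirst K y (pDelta P 0 g)) := fun y hy x' hx' => by
      rw [hf, fixFirst_deltaAct_prod_X, (h.tail hy).rowSum_eq_altSum hP0 hx']
    have hcorner : rowSum P (k 1) (Fin.tail (Fin.tail k))
        (fixFirst K (k 1) (fixFirst K (k 1) f)) = r := by
      rw [h.rowSum_corner_eq (sub_one_lt _), fixFirst_deltaAct_prod_X, fixFirst_deltaAct_prod_X]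
      exact ((h.tail hmem).tail (Finset.left_mem_Icc.mpr hle)).rowSum_eq_altSum hP0
        ((sub_one_lt _).trans_le hle)
    have hcorrected : ∀ y ∈ Finset.Icc (k 0) (k 1),
        entryWeight P x (k 1) y * rowSum P y (Fin.tail k) (fixFirst K y f) =
          entryWeight P x (k 1) y * altSum P (Fin.tail k) (fixFirst K y (pDelta P 0 g)) -
            if y = k 1 then entryWeight P x (k 1) y * r else 0 := fun y hy => by
      split_ifs with hyc
      · rw [hyc, ← hcorner, ← hrow _ hmem _ (sub_one_lt _), ← mul_sub]
        exact congrArg _ (rowSum_head_eq_sub P hle (sub_one_lt _) _)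
      · rw [hrow y hy y ((Finset.mem_Icc.mp hy).2.lt_of_ne hyc), sub_zero]
    rw [rowSum_succ, Finset.sum_congr rfl hcorrected, Finset.sum_sub_distrib,
      sum_entryWeight_mul_map hP0 hx h.head_le, Finset.sum_ite_eq', if_pos hmem,
      entryWeight_self_of_ne (hx.trans_le h.head_le).ne', one_mul,
      altSum_tail_fixFirst k h.diagonalVanishing, altSum_succ P k, hr]
    ring

end RowSummation

theorem rowSum_operatorFormula {K : Type*} [Field K] {P : K} {n : ℕ} (hP0 : P ≠ 0)
    (hP : ∀ m : ℕ, 0 < m → m < n + 1 → P ^ m ≠ 1) {x : ℤ} {k : Fin (n + 1) → ℤ}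
    (hk : Monotone k) (hx : x < k 0)
    (htriple : ∀ l ∈ rowsAbove k, HasTriple l → operatorFormula P n l = 0) :
    rowSum P x k (operatorFormula P n) = operatorFormula P (n + 1) k := by
  have hdelta := deltaAct_prod_X_operatorPrimitive hP0 hP
  have hg : IsRowSummable P k (operatorPrimitive P n) :=
    ⟨hk, diagonalVanishing_deltaAct_pairPolyProd P _, by rwa [hdelta]⟩
  rw [← hdelta, hg.rowSum_eq_altSum hP0 hx, operatorFormula_succ]

section Triangles

variable {n : ℕ}

/-- The triangle with `n + 1` rows obtained from `b` by adding the bottom row `k`. -/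
def addRow (k : Fin (n + 1) → ℤ) (b : ℕ → ℕ → ℤ) : ℕ → ℕ → ℤ
  | 1, j + 1 => if h : j < n + 1 then k ⟨j, h⟩ else 0
  | i + 2, j + 1 => b (i + 1) j
  | _, _ => 0

/-- The triangle obtained from `a` by deleting the bottom row. -/
def dropRow (a : ℕ → ℕ → ℤ) : ℕ → ℕ → ℤ
  | 0, _ => 0
  | i + 1, j => a (i + 2) (j + 1)

variable (n) in
/-- The row above the bottom row of a triangle with `n + 1` rows. -/
def secondRow (a : ℕ → ℕ → ℤ) (j : Fin n) : ℤ :=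
  a 2 (j + 2)

/-- The strict inequalities of a weak monotone triangle between a row `l` and the row `k` below
it. -/
def IsStrictRow (k : Fin (n + 1) → ℤ) (l : Fin n → ℤ) : Prop :=
  ∀ ⦃i j : Fin n⦄, i ⋖ j → l i < k j.succ

theorem addRow_one_of_lt (k : Fin (n + 1) → ℤ) (b : ℕ → ℕ → ℤ) {j : ℕ} (hj : j < n + 1) :
    addRow k b 1 (j + 1) = k ⟨j, hj⟩ :=
  dif_pos hj

theorem addRow_add_two (k : Fin (n + 1) → ℤ) (b : ℕ → ℕ → ℤ) (i j : ℕ) :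
    addRow k b (i + 2) (j + 1) = b (i + 1) j :=
  rfl

theorem apply_one_of_mem {k : Fin n → ℤ} {a : ℕ → ℕ → ℤ} (ha : a ∈ weakMonotoneTriangles k)
    {j : ℕ} (hj : j < n) : a 1 (j + 1) = k ⟨j, hj⟩ :=
  ha.2 ⟨j, hj⟩

theorem isGelfandTsetlin_addRow {k : Fin (n + 1) → ℤ} {l : Fin n → ℤ} (hl : l ∈ rowsAbove k)
    {b : ℕ → ℕ → ℤ} (hb : b ∈ weakMonotoneTriangles l) :
    IsGelfandTsetlin (n + 1) (addRow k b) where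
  le_northeast := by
    rintro (_ | _ | i) (_ | j) h1 h2 h3
    any_goals lia
    · rw [addRow_one_of_lt k b (by lia), addRow_add_two, apply_one_of_mem hb (by lia)]
      exact (mem_rowsAbove.mp hl ⟨j, by lia⟩).1
    · exact hb.1.le_northeast (i + 1) j (by lia) (by lia) (by lia)
  le_southeast := by
    rintro (_ | _ | _ | i) (_ | _ | j) h1 h2 h3
    any_goals lia
    · rw [Nat.add_one_sub_one, addRow_one_of_lt k b (by lia), addRow_add_two,
        apply_one_of_mem hb (by lia)]
      exact (mem_rowsAbove.mp hl ⟨j, by lia⟩).2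
    · exact hb.1.le_southeast (i + 2) (j + 1) (by lia) (by lia) (by lia)
  zero_outside := by
    rintro (_ | _ | i) (_ | j) h
    any_goals rfl
    · exact dif_neg (by lia)
    · exact hb.1.zero_outside _ _ (by lia)

theorem addRow_mem {k : Fin (n + 1) → ℤ} {l : Fin n → ℤ} (hl : l ∈ rowsAbove k)
    (hs : IsStrictRow k l) {b : ℕ → ℕ → ℤ} (hb : b ∈ weakMonotoneTriangles l) :
    addRow k b ∈ weakMonotoneTriangles k := by
  refine ⟨⟨isGelfandTsetlin_addRow hl hb, ?_⟩, fun j => addRow_one_of_lt k b j.is_lt⟩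
  rintro (_ | _ | _ | i) (_ | _ | _ | j) h1 h2 h3
  any_goals lia
  · rw [Nat.add_one_sub_one, Nat.add_one_sub_one, addRow_one_of_lt k b (by lia), addRow_add_two,
      apply_one_of_mem hb (by lia)]
    exact hs (i := ⟨j, by lia⟩) (j := ⟨j + 1, by lia⟩)
      (Fin.covBy_iff.mpr (Order.covBy_add_one j))
  · exact hb.1.lt_of_ne_bottom (i + 2) (j + 2) (by lia) (by lia) (by lia)

theorem secondRow_mem_rowsAbove {k : Fin (n + 1) → ℤ} {a : ℕ → ℕ → ℤ}
    (ha : a ∈ weakMonotoneTriangles k) : secondRow n a ∈ rowsAbove k := by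
  refine mem_rowsAbove.mpr fun j => ⟨?_, ?_⟩
  · rw [← ha.2 j.castSucc]
    exact ha.1.le_northeast 1 (j + 1) le_rfl (by lia) (by lia)
  · rw [← ha.2 j.succ]
    exact ha.1.le_southeast 2 (j + 2) one_lt_two (by lia) (by lia)

theorem isStrictRow_secondRow {k : Fin (n + 1) → ℤ} {a : ℕ → ℕ → ℤ}
    (ha : a ∈ weakMonotoneTriangles k) : IsStrictRow k (secondRow n a) := by
  intro i j hij
  have hval := val_add_one_eq_of_covBy hij
  calc secondRow n a i = a 2 (j + 2 - 1) := by rw [secondRow, ← hval]; rfl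
    _ < a 1 (j + 2) := ha.1.lt_of_ne_bottom 2 (j + 2) one_lt_two (by lia) (by lia)
    _ = k j.succ := ha.2 j.succ

theorem dropRow_mem {k : Fin (n + 1) → ℤ} {a : ℕ → ℕ → ℤ}
    (ha : a ∈ weakMonotoneTriangles k) : dropRow a ∈ weakMonotoneTriangles (secondRow n a) where
  left :=
    { le_northeast := by
        rintro (_ | i) j h1 h2 h3
        · lia
        · exact ha.1.le_northeast (i + 2) (j + 1) (by lia) (by lia) (by lia)
      le_southeast := by
        rintro (_ | _ | i) j h1 h2 h3
        any_goals lia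
        exact ha.1.le_southeast (i + 3) (j + 1) (by lia) (by lia) (by lia)
      zero_outside := by
        rintro (_ | i) j h
        · rfl
        · exact ha.1.zero_outside _ _ (by lia)
      lt_of_ne_bottom := by
        rintro (_ | _ | i) (_ | j) h1 h2 h3
        any_goals lia
        exact ha.1.lt_of_ne_bottom (i + 3) (j + 2) (by lia) (by lia) (by lia) }
  right _ := rfl

theorem addRow_dropRow {k : Fin (n + 1) → ℤ} {a : ℕ → ℕ → ℤ}
    (ha : a ∈ weakMonotoneTriangles k) : addRow k (dropRow a) = a := by
  funext i j
  rcases i with _ | _ | i <;> rcases j with _ | j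
  case succ.zero.succ =>
    by_cases h : j < n + 1
    · rw [addRow_one_of_lt _ _ h, apply_one_of_mem ha h]
    · rw [ha.1.zero_outside _ _ (by lia)]
      exact dif_neg h
  case succ.succ.succ => rfl
  all_goals exact (ha.1.zero_outside _ _ (by lia)).symm

theorem dropRow_addRow (k : Fin (n + 1) → ℤ) {l : Fin n → ℤ} {b : ℕ → ℕ → ℤ}
    (hb : b ∈ weakMonotoneTriangles l) : dropRow (addRow k b) = b := by
  funext i j
  rcases i with _ | i
  · exact (hb.1.zero_outside _ _ (by lia)).symm
  · rfl

theorem secondRow_addRow (k : Fin (n + 1) → ℤ) {l : Fin n → ℤ} {b : ℕ → ℕ → ℤ}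
    (hb : b ∈ weakMonotoneTriangles l) : secondRow n (addRow k b) = l :=
  funext hb.2

theorem injOn_addRow (k : Fin (n + 1) → ℤ) (l : Fin n → ℤ) :
    Set.InjOn (addRow k) (weakMonotoneTriangles l) :=
  Set.LeftInvOn.injOn (f₁' := dropRow) fun _ hb => dropRow_addRow k hb

theorem pairwiseDisjoint_image_addRow (k : Fin (n + 1) → ℤ) (s : Set (Fin n → ℤ)) :
    s.PairwiseDisjoint fun l => addRow k '' weakMonotoneTriangles l := by
  rintro l - l' - hne
  refine Set.disjoint_left.mpr ?_
  rintro _ ⟨b, hb, rfl⟩ ⟨b', hb', h⟩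
  exact hne (by rw [← secondRow_addRow k hb, ← h, secondRow_addRow k hb'])

open scoped Classical in
theorem weakMonotoneTriangles_succ (k : Fin (n + 1) → ℤ) :
    weakMonotoneTriangles k =
      ⋃ l ∈ {l ∈ rowsAbove k | IsStrictRow k l}, addRow k '' weakMonotoneTriangles l := by
  ext a
  simp only [Set.mem_iUnion, Finset.mem_filter, exists_prop]
  constructor
  · exact fun ha => ⟨secondRow n a, ⟨secondRow_mem_rowsAbove ha, isStrictRow_secondRow ha⟩,
      dropRow a, dropRow_mem ha, addRow_dropRow ha⟩
  · rintro ⟨l, ⟨hl, hs⟩, b, hb, rfl⟩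
    exact addRow_mem hl hs hb

theorem weakMonotoneTriangles_zero (k : Fin 0 → ℤ) : weakMonotoneTriangles k = {0} := by
  refine Set.Subset.antisymm (fun a ha => ?_) (Set.singleton_subset_iff.mpr ?_)
  · funext i j
    exact ha.1.zero_outside i j (by lia)
  · exact ⟨⟨⟨fun _ _ _ _ _ => le_rfl, fun _ _ _ _ _ => le_rfl, fun _ _ _ => rfl⟩,
      fun _ _ _ _ _ => by lia⟩, fun j => j.elim0⟩

theorem finite_weakMonotoneTriangles (k : Fin n → ℤ) : (weakMonotoneTriangles k).Finite := by
  classical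
  induction n with
  | zero => rw [weakMonotoneTriangles_zero]; exact Set.finite_singleton 0
  | succ n ih =>
    rw [weakMonotoneTriangles_succ]
    exact (Finset.finite_toSet _).biUnion fun l _ => (ih l).image _

theorem weakMonotoneTriangles_eq_empty {k : Fin n → ℤ} (h : HasTriple k) :
    weakMonotoneTriangles k = ∅ := by
  obtain ⟨i, j, m, hij, hjm, hki, hkj⟩ := h
  have hj := val_add_one_eq_of_covBy hij
  have hm := val_add_one_eq_of_covBy hjm
  refine Set.eq_empty_of_forall_notMem fun a ha => lt_irrefl (k m) ?_
  calc k m = a 1 (i + 1) := by rw [ha.2 i, hki, hkj]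
    _ ≤ a 2 (i + 2) := ha.1.le_northeast 1 (i + 1) le_rfl (by lia) (by lia)
    _ = a 2 (m + 1 - 1) := by rw [← hm, ← hj]; rfl
    _ < a 1 (m + 1) := ha.1.lt_of_ne_bottom 2 (m + 1) one_lt_two (by lia) (by lia)
    _ = k m := ha.2 m

end Triangles

section Weights

variable {K : Type*} [Field K] (P : K) {n : ℕ}

/-- The factor of the `P`-weight of a triangle that belongs to the entry `a (i + 1) (j + 1)`. -/
def cellWeight (a : ℕ → ℕ → ℤ) (i j : ℕ) : K :=
  if 0 < i ∧ i ≤ j ∧ a (i + 1) (j + 1) < a i (j + 1) then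
    P ^ a (i + 1) (j + 1) - if i < j ∧ a (i + 1) (j + 1) = a (i + 1) j then 1 else 0
  else 1

variable {P} in
theorem cellWeight_of_not {i j : ℕ} (h : ¬(0 < i ∧ i ≤ j)) (a : ℕ → ℕ → ℤ) :
    cellWeight P a i j = 1 :=
  if_neg fun h' => h ⟨h'.1, h'.2.1⟩

-- The row `i = 0` and the row `i = n`, which lies outside of the triangle, have weight one.
theorem pWeight_eq_prod_cellWeight (n : ℕ) (a : ℕ → ℕ → ℤ) :
    pWeight P n a = ∏ i ∈ Finset.range n, ∏ j ∈ Finset.range n, cellWeight P a (i + 1) j := by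
  let F (i : ℕ) : K := ∏ j ∈ Finset.range n, cellWeight P a i j
  have hIcc (f : ℕ → K) : ∏ i ∈ Finset.Icc 1 n, f i = ∏ i ∈ Finset.range n, f (i + 1) := by
    rw [Finset.range_eq_Ico, Finset.prod_Ico_add' f 0 n 1]
    rfl
  have hbottom : F 0 = 1 := Finset.prod_eq_one fun j _ => cellWeight_of_not (by lia) a
  have htop : F n = 1 := Finset.prod_eq_one fun j hj =>
    cellWeight_of_not (by rw [Finset.mem_range] at hj; lia) a
  calc pWeight P n a = ∏ i ∈ Finset.range n, F i := by
        simp only [pWeight, strictIndices, Finset.prod_filter, Finset.prod_product, hIcc, F,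
          cellWeight, Nat.add_sub_cancel, Nat.lt_add_left_iff_pos, Nat.add_le_add_iff_right,
          Nat.add_lt_add_iff_right]
    _ = ∏ i ∈ Finset.range (n + 1), F i := by rw [Finset.prod_range_succ, htop, mul_one]
    _ = ∏ i ∈ Finset.range n, F (i + 1) := by rw [Finset.prod_range_succ', hbottom, mul_one]

theorem cellWeight_addRow_add_two (k : Fin (n + 1) → ℤ) (b : ℕ → ℕ → ℤ) (i j : ℕ) :
    cellWeight P (addRow k b) (i + 2) (j + 1) = cellWeight P b (i + 1) j := by
  rcases j with _ | j
  · rw [cellWeight_of_not (by lia), cellWeight_of_not (by lia)]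
  · simp [cellWeight, addRow_add_two]

theorem castSucc_eq_succ_of_covBy {i j : Fin n} (hij : i ⋖ j) : j.castSucc = i.succ :=
  Fin.ext (val_add_one_eq_of_covBy hij).symm

theorem cellWeight_addRow_one {x : ℤ} {k : Fin (n + 1) → ℤ} {l : Fin n → ℤ} (hx : x < k 0)
    (hl : l ∈ rowsAbove k) (hs : IsStrictRow k l) {b : ℕ → ℕ → ℤ}
    (hb : b ∈ weakMonotoneTriangles l) (j : Fin n) :
    cellWeight P (addRow k b) 1 (j + 1) =
      entryWeight P ((Fin.cons x l : Fin (n + 1) → ℤ) j.castSucc) (k j.succ) (l j) := by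
  have hcell : cellWeight P (addRow k b) 1 (j + 1) = if l j < k j.succ then
      P ^ l j - if 0 < (j : ℕ) ∧ l j = b 1 j then 1 else 0 else 1 := by
    simp [cellWeight, addRow_add_two, hb.2 j, addRow_one_of_lt k b (Nat.succ_lt_succ j.is_lt),
      ← Fin.succ_mk]
  obtain ⟨hlt, hiff⟩ : (Fin.cons x l : Fin (n + 1) → ℤ) j.castSucc < k j.succ ∧
      (0 < (j : ℕ) ∧ l j = b 1 j ↔ l j = (Fin.cons x l : Fin (n + 1) → ℤ) j.castSucc) := by
    obtain ⟨_ | j, hj⟩ := j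
    · have hx0 : x < l ⟨0, hj⟩ := hx.trans_le (mem_rowsAbove.mp hl _).1
      exact ⟨hx0.trans_le (mem_rowsAbove.mp hl _).2, by simp [hx0.ne']⟩
    · have hcov : (⟨j, by lia⟩ : Fin n) ⋖ ⟨j + 1, hj⟩ := Fin.covBy_iff.mpr (Order.covBy_add_one j)
      rw [castSucc_eq_succ_of_covBy hcov, Fin.cons_succ, apply_one_of_mem hb (by lia)]
      exact ⟨hs hcov, by simp⟩
  rw [hcell, entryWeight]
  simp only [hiff]
  split_ifs with h₁ h₂ h₃
  · rfl
  · rfl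
  · exact absurd (h₃ ▸ hlt) h₁
  · rw [sub_zero]

theorem pWeight_addRow {x : ℤ} {k : Fin (n + 1) → ℤ} {l : Fin n → ℤ} (hx : x < k 0)
    (hl : l ∈ rowsAbove k) (hs : IsStrictRow k l) {b : ℕ → ℕ → ℤ}
    (hb : b ∈ weakMonotoneTriangles l) :
    pWeight P (n + 1) (addRow k b) = rowWeight P x k l * pWeight P n b := by
  have hcolumn (i : ℕ) : cellWeight P (addRow k b) (i + 1) 0 = 1 := cellWeight_of_not (by lia) _
  have hrow : ∏ j ∈ Finset.range n, cellWeight P (addRow k b) 1 (j + 1) = rowWeight P x k l := by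
    rw [Finset.prod_range, rowWeight]
    exact Finset.prod_congr rfl fun j _ => cellWeight_addRow_one P hx hl hs hb j
  simp only [pWeight_eq_prod_cellWeight, Finset.prod_range_succ', hcolumn, mul_one, zero_add, hrow,
    cellWeight_addRow_add_two, mul_comm (rowWeight P x k l)]

theorem rowWeight_eq_zero_of_not_isStrictRow {k : Fin (n + 1) → ℤ} {l : Fin n → ℤ}
    (hl : l ∈ rowsAbove k) (hs : ¬IsStrictRow k l) (x : ℤ) : rowWeight P x k l = 0 := by
  simp only [IsStrictRow, not_forall, not_lt] at hs
  obtain ⟨i, j, hij, hle⟩ := hs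
  have hk : k j.castSucc ≤ l j ∧ l j ≤ k j.succ := mem_rowsAbove.mp hl j
  have hi : l i ≤ k j.castSucc := by
    rw [castSucc_eq_succ_of_covBy hij]
    exact (mem_rowsAbove.mp hl i).2
  refine Finset.prod_eq_zero (Finset.mem_univ j) ?_
  rw [castSucc_eq_succ_of_covBy hij, Fin.cons_succ, entryWeight, if_neg (by lia), if_pos (by lia),
    sub_self]

end Weights

section Enumeration

variable {K : Type*} [Field K] (P : K) {n : ℕ}

/-- The weighted enumeration of the weak monotone triangles with bottom row `k`. -/
noncomputable def triangleSum (k : Fin n → ℤ) : K :=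
  ∑ᶠ a ∈ weakMonotoneTriangles k, pWeight P n a

theorem triangleSum_zero (k : Fin 0 → ℤ) : triangleSum P k = 1 := by
  rw [triangleSum, weakMonotoneTriangles_zero, finsum_mem_singleton, pWeight_eq_prod_cellWeight,
    Finset.prod_range_zero]

theorem triangleSum_eq_zero_of_hasTriple {k : Fin n → ℤ} (h : HasTriple k) :
    triangleSum P k = 0 := by
  rw [triangleSum, weakMonotoneTriangles_eq_empty h, finsum_mem_empty]

theorem triangleSum_succ {x : ℤ} {k : Fin (n + 1) → ℤ} (hx : x < k 0) :
    triangleSum P k = rowSum P x k (triangleSum P) := by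
  classical
  have hfinite (l : Fin n → ℤ) : (addRow k '' weakMonotoneTriangles l).Finite :=
    (finite_weakMonotoneTriangles l).image _
  have hrow : ∀ l ∈ ({l ∈ rowsAbove k | IsStrictRow k l} : Finset (Fin n → ℤ)),
      ∑ᶠ a ∈ addRow k '' weakMonotoneTriangles l, pWeight P (n + 1) a =
        rowWeight P x k l * triangleSum P l := fun l hl => by
    obtain ⟨hl, hs⟩ := Finset.mem_filter.mp hl
    rw [finsum_mem_image (injOn_addRow k l),
      finsum_mem_congr rfl fun b hb => pWeight_addRow P hx hl hs hb, triangleSum, mul_finsum_mem]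
  rw [triangleSum, weakMonotoneTriangles_succ]
  simp only [← Finset.mem_coe]
  rw [finsum_mem_biUnion (pairwiseDisjoint_image_addRow k _) (Finset.finite_toSet _)
      fun l _ => hfinite l, finsum_mem_coe_finset, Finset.sum_congr rfl hrow, rowSum]
  refine Finset.sum_filter_of_ne fun l hl hne => ?_
  by_contra hs
  exact hne (by rw [rowWeight_eq_zero_of_not_isStrictRow P hl hs, zero_mul])

theorem monotone_of_mem_rowsAbove {k : Fin (n + 1) → ℤ} {l : Fin n → ℤ} (hl : l ∈ rowsAbove k) :
    Monotone l := by
  cases n with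
  | zero => exact Subsingleton.monotone l
  | succ n =>
    refine Fin.monotone_iff_le_succ.mpr fun i => ?_
    exact (mem_rowsAbove.mp hl i.castSucc).2.trans (mem_rowsAbove.mp hl i.succ).1

variable {P} in
theorem triangleSum_eq_operatorFormula (hP0 : P ≠ 0) (hP : ∀ m : ℕ, 0 < m → m < n → P ^ m ≠ 1)
    {k : Fin n → ℤ} (hk : Monotone k) : triangleSum P k = operatorFormula P n k := by
  induction n with
  | zero => simp [triangleSum_zero, operatorFormula, pairPolyProd, funDet]
  | succ n ih =>
    have hrow : ∀ l ∈ rowsAbove k, triangleSum P l = operatorFormula P n l := fun l hl =>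
      ih (fun m h0 hm => hP m h0 (hm.trans (Nat.lt_succ_self n))) (monotone_of_mem_rowsAbove hl)
    have hx : k 0 - 1 < k 0 := sub_one_lt _
    calc triangleSum P k = rowSum P (k 0 - 1) k (triangleSum P) := triangleSum_succ P hx
      _ = rowSum P (k 0 - 1) k (operatorFormula P n) :=
        Finset.sum_congr rfl fun l hl => by rw [hrow l hl]
      _ = operatorFormula P (n + 1) k := rowSum_operatorFormula hP0 hP hk hx fun l hl h => by
        rw [← hrow l hl, triangleSum_eq_zero_of_hasTriple P h]

end Enumeration

section Vandermonde

variable {K : Type*} [Field K]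

theorem prod_filter_lt_eq_prod_Ioi {M : Type*} [CommMonoid M] (n : ℕ) (f : Fin n → Fin n → M) :
    ∏ p : Fin n × Fin n with p.1 < p.2, f p.1 p.2 = ∏ i, ∏ j ∈ Finset.Ioi i, f i j := by
  rw [Finset.prod_filter, ← Finset.univ_product_univ, Finset.prod_product]
  refine Finset.prod_congr rfl fun i _ => ?_
  rw [← Finset.prod_filter, Finset.filter_lt_eq_Ioi]

theorem sum_range_succ_choose_succ (n m : ℕ) :
    ∑ j ∈ Finset.range n, (j + 1).choose (m + 1) = (n + 1).choose (m + 2) := by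
  induction n with
  | zero => exact (Nat.choose_eq_zero_of_lt (by lia)).symm
  | succ n ih => rw [Finset.sum_range_succ, ih, add_comm, ← Nat.choose_succ_succ]

theorem prod_pow_sub_pow_succ (P : K) (n : ℕ) :
    ∏ i ∈ Finset.range n, (P ^ (n + 1) - P ^ (i + 1)) =
      P ^ ((n + 1).choose 2) * ∏ r ∈ Finset.range n, (P ^ (r + 1) - 1) := by
  have hfactor : ∀ i ∈ Finset.range n,
      P ^ (n + 1) - P ^ (i + 1) = P ^ (i + 1) * (P ^ (n - 1 - i + 1) - 1) := fun i hi => by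
    have hi := Finset.mem_range.mp hi
    rw [mul_sub, ← pow_add, mul_one, show i + 1 + (n - 1 - i + 1) = n + 1 by lia]
  have hexponent : ∑ i ∈ Finset.range n, (i + 1) = (n + 1).choose 2 := by
    simpa only [zero_add, Nat.choose_one_right] using sum_range_succ_choose_succ n 0
  rw [Finset.prod_congr rfl hfactor, Finset.prod_mul_distrib,
    Finset.prod_range_reflect (fun r => P ^ (r + 1) - 1), Finset.prod_pow_eq_pow_sum, hexponent]

theorem det_vandermonde_eq_prod_range {R : Type*} [CommRing R] (n : ℕ) (v : ℕ → R) :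
    (Matrix.vandermonde fun j : Fin n => v j).det =
      ∏ j ∈ Finset.range n, ∏ i ∈ Finset.range j, (v j - v i) := by
  rw [Matrix.det_vandermonde, Finset.prod_comm' (s' := Finset.Iio) (t' := Finset.univ) (by simp),
    Finset.prod_range]
  refine Finset.prod_congr rfl fun j _ => ?_
  rw [← Nat.Iio_eq_range, ← Fin.map_valEmbedding_Iio, Finset.prod_map]
  rfl

theorem det_vandermonde_pow_succ (P : K) (n : ℕ) :
    (Matrix.vandermonde fun j : Fin n => P ^ ((j : ℕ) + 1)).det =
      P ^ ((n + 1).choose 3) * ∏ j : Fin n, ∏ r ∈ Finset.range j, (P ^ (r + 1) - 1) := by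
  rw [det_vandermonde_eq_prod_range n fun j => P ^ (j + 1)]
  simp only [prod_pow_sub_pow_succ]
  rw [Finset.prod_mul_distrib, Finset.prod_pow_eq_pow_sum, sum_range_succ_choose_succ,
    Finset.prod_range fun j => ∏ r ∈ Finset.range j, (P ^ (r + 1) - 1)]

theorem funDet_divPow (P : K) (n : ℕ) (k : Fin n → ℤ) :
    funDet (fun j => divPow P j) k =
      (Matrix.vandermonde fun i : Fin n => P ^ k i).det /
        ∏ j : Fin n, ∏ r ∈ Finset.range j, (P ^ (r + 1) - 1) := by
  rw [div_eq_inv_mul, ← Finset.prod_inv_distrib, ← Matrix.det_mul_row, funDet]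
  simp only [divPow, Matrix.vandermonde_apply, div_eq_inv_mul]

theorem pVandermonde_eq_div (P : K) (n : ℕ) (k : Fin n → ℤ) :
    pVandermonde P n k = (Matrix.vandermonde fun i : Fin n => P ^ k i).det /
      (Matrix.vandermonde fun j : Fin n => P ^ ((j : ℕ) + 1)).det := by
  rw [pVandermonde, Finset.prod_div_distrib, Matrix.det_vandermonde, Matrix.det_vandermonde]
  simp only [prod_filter_lt_eq_prod_Ioi n fun i j => P ^ k j - P ^ k i,
    prod_filter_lt_eq_prod_Ioi n fun i j => P ^ ((j : ℕ) + 1) - P ^ ((i : ℕ) + 1)]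

theorem funDet_divPow_eq_smul_pVandermonde {P : K} (hP0 : P ≠ 0) (n : ℕ) :
    (funDet fun j : Fin n => divPow P j) = P ^ ((n + 1).choose 3) • pVandermonde P n := by
  ext k
  rw [funDet_divPow, Pi.smul_apply, pVandermonde_eq_div, det_vandermonde_pow_succ, smul_eq_mul,
    ← mul_div_assoc, mul_div_mul_left _ _ (pow_ne_zero _ hP0)]

theorem operatorFormula_eq {P : K} (hP0 : P ≠ 0) (n : ℕ) (k : Fin n → ℤ) :
    operatorFormula P n k = P ^ ((n + 1).choose 3) * pairOpProd P n (pVandermonde P n) k := by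
  rw [operatorFormula, deltaAct_pairPolyProd, funDet_divPow_eq_smul_pVandermonde hP0, map_smul,
    Pi.smul_apply, smul_eq_mul]

end Vandermonde

theorem theorem2 {K : Type*} [Field K] (P : K) (n : ℕ) (hP0 : P ≠ 0)
    (hP : ∀ m : ℕ, 0 < m → m < n → P ^ m ≠ 1)
    (k : Fin n → ℤ) (hk : Monotone k) :
    (weakMonotoneTriangles k).Finite ∧
      ∑ᶠ a ∈ weakMonotoneTriangles k, pWeight P n a =
        P ^ ((n + 1).choose 3) * pairOpProd P n (pVandermonde P n) k := by
  refine ⟨finite_weakMonotoneTriangles k, ?_⟩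
  calc ∑ᶠ a ∈ weakMonotoneTriangles k, pWeight P n a = triangleSum P k := rfl
    _ = operatorFormula P n k := triangleSum_eq_operatorFormula hP0 hP hk
    _ = P ^ ((n + 1).choose 3) * pairOpProd P n (pVandermonde P n) k := operatorFormula_eq hP0 n k
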